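/- All graphs are finite and simple, without loops. A multi-homomorphism from a graph $T$ to a graph $G$ is a function $\phi$ assigning to each vertex of $T$ a nonempty subset of $V(G)$ such that every $f\colon V(T)\to V(G)$ with $f(u)\in\phi(u)$ for all $u$ is a graph homomorphism. The space $\mathrm{Hom}(T,G)$ is the subcomplex of $\prod_{u\in V(T)}\Delta^{V(G)}$ (where $\Delta^{V(G)}$ is the standard simplex with vertex set $V(G)$) consisting of the cells $\prod_{u}\Delta^{\phi(u)}$ for all multi-homomorphisms $\phi$. Let $\mathbb Z_2$ act on $\mathrm{Hom}(K_2,G)$ by precomposition with the involution $v\mapsto 1-v$ of $K_2$ (with vertex set $\{0,1\}$), and on $\mathrm{Hom}(C_{2r+1},G)$, where $r\ge 1$, by precomposition with the involution $v\mapsto 2r-v$ of the cycle $C_{2r+1}$ (with vertex set $\{0,\dots,2r\}$). For a space $X$ with an involution, let $\operatorname{coind}X$ be the largest integer $k\ge-1$ for which there is a continuous equivariant map from the sphere $S^k$ with the antipodal action to $X$, where $S^{-1}=\emptyset$ (and $\operatorname{coind}X=\infty$ if such maps exist for all $k$). Let $G$ be a graph with at least one edge. Then the limit $\lim_{r\to\infty}\operatorname{coind}\mathrm{Hom}(C_{2r+1},G)$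 exists and is an integer, and \[\operatorname{coind}\mathrm{Hom}(K_2,G)\le\lim_{r\to\infty}\operatorname{coind}\mathrm{Hom}(C_{2r+1},G)+1.\] Consequently, the Babson--Kozlov lower bound for the chromatic number is never weaker than Lovász's: for all sufficiently large $r$, \[\operatorname{coind}\mathrm{Hom}(K_2,G)+2\le\operatorname{coind}\mathrm{Hom}(C_{2r+1},G)+3.\] -/

import Mathlib

open Filter Topology

/-- A multi-homomorphism from `T` to `G`: a function assigning to every vertex of `T` a nonempty
set of vertices of `G` such that every selection is a graph homomorphism. -/
def IsMultiHom {U V : Type*} (T : SimpleGraph U) (G : SimpleGraph V) (φ : U → Set V) : Prop :=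
  (∀ u, (φ u).Nonempty) ∧
    ∀ f : U → V, (∀ u, f u ∈ φ u) → ∃ h : T →g G, (h : U → V) = f

/-- The closed cell `∏ u, Δ^(φ u)` of the product `∏ u, Δ^V` of standard simplices. -/
def homCell {U V : Type*} [Fintype V] (φ : U → Set V) : Set (U → V → ℝ) :=
  {x | ∀ u, x u ∈ stdSimplex ℝ V ∧ ∀ v, x u v ≠ 0 → v ∈ φ u}

/-- The underlying space of the cell complex `Hom(T, G)`: the union of the cells of
`∏ u, Δ^V` indexed by multi-homomorphisms. It carries the subspace topology. -/
def homComplex {U V : Type*} [Fintype V] (T : SimpleGraph U) (G : SimpleGraph V) :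
    Set (U → V → ℝ) :=
  {x | ∃ φ : U → Set V, IsMultiHom T G φ ∧ x ∈ homCell φ}

theorem homComplex_comp {U V : Type*} [Fintype V] {T : SimpleGraph U} {G : SimpleGraph V}
    (α : T ≃g T) {x : U → V → ℝ} (hx : x ∈ homComplex T G) :
    (fun u => x (α u)) ∈ homComplex T G := by
  obtain ⟨φ, ⟨hne, hφ⟩, hx⟩ := hx
  refine ⟨fun u => φ (α u), ⟨fun u => hne _, fun f hf => ?_⟩, fun u => hx (α u)⟩
  obtain ⟨h, hh⟩ := hφ (fun u => f (α.symm u)) (fun u => by simpa using hf (α.symm u))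
  refine ⟨h.comp α.toHom, funext fun u => ?_⟩
  have := congrFun hh (α u)
  simpa using this

/-- The action of an automorphism `α` of `T` on the space `Hom(T, G)` by precomposition. -/
def homAct {U V : Type*} [Fintype V] {T : SimpleGraph U} (α : T ≃g T) (G : SimpleGraph V) :
    homComplex T G → homComplex T G :=
  fun x => ⟨fun u => x.1 (α u), homComplex_comp α x.2⟩

/-- `HasSphereMap τ n` says that there is a `ℤ/2`-map from the unit sphere of `ℝⁿ`, that is the
`(n-1)`-sphere with the antipodal action, to the space `X` with the involution `τ`.
For `n = 0` the sphere is empty. -/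
def HasSphereMap {X : Type*} [TopologicalSpace X] (τ : X → X) (n : ℕ) : Prop :=
  ∃ f : C(Metric.sphere (0 : EuclideanSpace ℝ (Fin n)) 1, X), ∀ x, f (-x) = τ (f x)

/-- The coindex of the space `X` with the involution `τ`: the largest `k ≥ -1` such that there is
a `ℤ/2`-map from the `k`-sphere to `X` (and `∞` if there are such maps for all `k`). -/
noncomputable def coind {X : Type*} [TopologicalSpace X] (τ : X → X) : EReal :=
  sSup {c : EReal | ∃ n : ℕ, HasSphereMap τ n ∧ c = (((n : ℝ) - 1 : ℝ) : EReal)}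

/-- The involution `v ↦ 1 - v` of `K₂`. -/
def edgeFlip : (⊤ : SimpleGraph (Fin 2)) ≃g (⊤ : SimpleGraph (Fin 2)) where
  toEquiv := Fin.revPerm
  map_rel_iff' := by simp

/-- The involution `v ↦ 2r - v` of the cycle `C_{2r+1}`. -/
def cycleFlip (r : ℕ) :
    SimpleGraph.cycleGraph (2 * r + 1) ≃g SimpleGraph.cycleGraph (2 * r + 1) where
  toEquiv := Fin.revPerm
  map_rel_iff' := by
    intro a b
    have h : ∀ a b : Fin (2 * r + 1), a.rev - b.rev = b - a := fun a b => by
      simp [← Fin.last_sub]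
    simp only [Fin.revPerm_apply, SimpleGraph.cycleGraph_eq_circulantGraph,
      SimpleGraph.circulantGraph_adj, h]
    simp only [Fin.rev_inj]
    tauto

/-- The coindex of `Hom(K₂, G)`. -/
noncomputable def coindEdge {V : Type*} [Fintype V] (G : SimpleGraph V) : EReal :=
  coind (homAct edgeFlip G)

/-- The coindex of `Hom(C_{2r+1}, G)`. -/
noncomputable def coindCycle {V : Type*} [Fintype V] (G : SimpleGraph V) (r : ℕ) : EReal :=
  coind (homAct (cycleFlip r) G)

/-- Lovász's lower bound for the chromatic number of `G`. -/
noncomputable def lovaszBound {V : Type*} [Fintype V] (G : SimpleGraph V) : EReal :=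
  coindEdge G + 2

/-- The lower bound of Babson and Kozlov for the chromatic number of `G`
obtained from the cycle `C_{2r+1}`. -/
noncomputable def babsonKozlovBound {V : Type*} [Fintype V] (G : SimpleGraph V) (r : ℕ) : EReal :=
  coindCycle G r + 3

/-!
A point of `Hom(T, G)` is a family of points of the simplex on `V`, one for each vertex of `T`, such
that the supports at adjacent vertices of `T` are completely joined in `G` (`mem_homComplex_iff`).

Inequality. Let `F` be an equivariant map from the unit sphere of `ℝⁿ⁺¹` to `Hom(K₂, G)`. For `y` in
the equatorial sphere, follow the half great circle from `y` through the pole `e` to `-y`, and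
divide it into `2r` equal steps with end points `p₀ = y, p₁, …, p₂ᵣ = -y`. To the vertex `j` of
`C_{2r+1}` assign the component `j mod 2` of `F(pⱼ)`. Replacing `y` by `-y` reverses the half circle,
and `j ↦ 2r - j` preserves parity, so this is equivariant; the vertices `2r` and `0` carry the first
components of `F(-y)` and `F(y)`, that is both components of `F(y)`, which are joined. For
neighbouring `j` the two components are taken at different points, so their supports need not be
joined; this is repaired by first discarding all coordinates at most `ε` (`truncate`), which is
harmless once `F` varies by less than `ε` along one step. Hence a sphere map in dimension `n` for
`K₂` gives one in dimension `n - 1` for some odd cycle (`HasSphereMap.exists_cycle`).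

Limit. Folding `C_{2r+3}` equivariantly onto `C_{2r+1}` shows that the coindex grows with `r`
(`HasSphereMap.cycle_succ`). Since the edge `{0, 2r}` is flipped, `x ↦ x₀ - x₂ᵣ` is an odd map
without zeros from `Hom(C_{2r+1}, G)` to `ℝ^V`, so that the Borsuk–Ulam theorem bounds the coindex
independently of `r` (`HasSphereMap.cycle_le_card`), and the coindex is eventually constant.

Borsuk–Ulam (`exists_eq_zero_of_odd`). Suppose that `f` is an odd map without zeros from the unit
sphere of `ℝⁿ` to `ℝᵐ` with `m < n`. Let `sᵢ` be the sign of `fᵢ` as an element of `ℤ/2`, with ties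
broken in an odd way. The cup product `ds₁ ∪ ⋯ ∪ dsₘ` vanishes on every simplex with vertices
sufficiently close together, because some `sᵢ` is constant there. On the other hand, there are
`k`-chains `hₖ` of arbitrarily small simplices, subdividing the upper hemispheres of a flag of
spheres, such that `∂hₖ₊₁ = hₖ + τhₖ` with `τ` the antipode (`hemisphere_coboundary`). Together with
`ds ∪ ω = d(s ∪ ω)` and `s + τs = 1` this gives, by induction on `m`, that `ds₁ ∪ ⋯ ∪ dsₘ` takes the
value `1` on `hₘ` (`hemisphere_cupDiff`), a contradiction. All this is carried out on the side of
cochains, which are just functions from words of points to `ℤ/2`.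
-/

/-! ### Cochains on words -/

/-- The mod 2 coboundary of a cochain `θ`. A cochain is a function on words, the word `v₀ ⋯ vₖ`
standing for the ordered `k`-simplex with these vertices, and `coboundary θ w` is the sum of the
values of `θ` at the words that arise from `w` by deleting one letter. -/
def coboundary {X : Type*} : (List X → ZMod 2) → List X → ZMod 2
  | _, [] => 0
  | θ, v :: w => θ w + coboundary (fun u => θ (v :: u)) w

/-- The dual of the mod 2 prism operator for two vertex maps `φ` and `ψ`: the value of
`prism φ ψ θ` at `v₀ ⋯ vₖ` is the sum over `i` of `θ (φ v₀ ⋯ φ vᵢ ψ vᵢ ⋯ ψ vₖ)`. -/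
def prism {X : Type*} (φ ψ : X → X) : (List X → ZMod 2) → List X → ZMod 2
  | _, [] => 0
  | θ, v :: w => prism φ ψ (fun u => θ (φ v :: u)) w + θ (φ v :: ψ v :: w.map ψ)

theorem coboundary_add {X : Type*} (θ η : List X → ZMod 2) (w : List X) :
    coboundary (fun u => θ u + η u) w = coboundary θ w + coboundary η w := by
  induction w generalizing θ η with
  | nil => simp [coboundary]
  | cons v w ih => simp only [coboundary, ih]; ring

theorem coboundary_mul {X : Type*} (c : ZMod 2) (θ : List X → ZMod 2) (w : List X) :
    coboundary (fun u => c * θ u) w = c * coboundary θ w := by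
  induction w generalizing θ with
  | nil => simp [coboundary]
  | cons v w ih => simp only [coboundary, ih]; ring

theorem coboundary_comp_map {X Y : Type*} (φ : X → Y) (θ : List Y → ZMod 2) (w : List X) :
    coboundary (fun u => θ (u.map φ)) w = coboundary θ (w.map φ) := by
  induction w generalizing θ with
  | nil => rfl
  | cons v w ih => simp only [coboundary, List.map_cons, ih fun u => θ (φ v :: u)]

theorem prism_add {X : Type*} (φ ψ : X → X) (θ η : List X → ZMod 2) (w : List X) :
    prism φ ψ (fun u => θ u + η u) w = prism φ ψ θ w + prism φ ψ η w := by
  induction w generalizing θ η with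
  | nil => simp [prism]
  | cons v w ih => simp only [prism, ih]; ring

/-- The prism operator is a chain homotopy from `φ` to `ψ`. -/
theorem prism_coboundary {X : Type*} (φ ψ : X → X) (θ : List X → ZMod 2) (w : List X) :
    prism φ ψ (coboundary θ) w =
      θ (w.map φ) + θ (w.map ψ) + coboundary (prism φ ψ θ) w := by
  induction w generalizing θ with
  | nil => simp [prism, coboundary, CharTwo.add_self_eq_zero]
  | cons v w ih =>
    simp only [prism, coboundary, List.map_cons, prism_add, coboundary_add, ih,
      coboundary_comp_map ψ fun u => θ (φ v :: ψ v :: u)]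
    linear_combination θ (φ v :: w.map ψ) * (CharTwo.two_eq_zero : (2 : ZMod 2) = 0)

theorem prism_congr {X : Type*} {φ ψ : X → X} {θ η : List X → ZMod 2} {w : List X}
    (h : ∀ u : List X, u.length = w.length + 1 →
      (∀ x ∈ u, ∃ y ∈ w, x = φ y ∨ x = ψ y) → θ u = η u) :
    prism φ ψ θ w = prism φ ψ η w := by
  induction w generalizing θ η with
  | nil => rfl
  | cons v w ih =>
    rw [prism, prism]
    congr 1
    · refine ih fun u hu hu' => h _ (by simp [hu]) ?_
      simp only [List.mem_cons, forall_eq_or_imp, exists_eq_or_imp, true_or, true_and]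
      exact fun x hx => .inr (hu' x hx)
    · refine h _ (by simp) ?_
      simp only [List.mem_cons, forall_eq_or_imp, exists_eq_or_imp, true_or, or_true, true_and]
      intro x hx
      obtain ⟨y, hy, rfl⟩ := List.mem_map.1 hx
      exact .inr ⟨y, hy, .inr rfl⟩

/-- The cup product `ds₁ ∪ ⋯ ∪ dsₖ` of the coboundaries of the `0`-cochains in a list. It is
meaningful on words of length `k + 1`; its values at other words are irrelevant. -/
def cupDiff {X : Type*} : List (X → ZMod 2) → List X → ZMod 2
  | s :: l, v :: x :: w => (s v + s x) * cupDiff l (x :: w)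
  | _, _ => 1

theorem coboundary_cupDiff {X : Type*} (l : List (X → ZMod 2)) (w : List X)
    (hw : w.length = l.length + 2) : coboundary (cupDiff l) w = 0 := by
  have h2 : (2 : ZMod 2) = 0 := CharTwo.two_eq_zero
  induction l generalizing w with
  | nil =>
    obtain ⟨v, x, rfl⟩ := List.length_eq_two.1 hw
    simp [coboundary, cupDiff, CharTwo.add_self_eq_zero]
  | cons s l ih =>
    obtain _ | ⟨v, _ | ⟨x, _ | ⟨y, w⟩⟩⟩ := w
    any_goals simp at hw
    have := ih (x :: y :: w) (by simp [hw])
    simp only [coboundary] at this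
    simp only [coboundary, cupDiff, coboundary_mul]
    linear_combination (s v + s x) * this + (s y * cupDiff l (y :: w)) * h2

/-- The identity `d(s ∪ ds₁ ∪ ⋯ ∪ dsₖ) = ds ∪ ds₁ ∪ ⋯ ∪ dsₖ`. -/
theorem coboundary_mul_cupDiff {X : Type*} (s : X → ZMod 2) (l : List (X → ZMod 2)) (w : List X)
    (hw : w.length = l.length + 2) :
    coboundary (fun u => (u.head?.elim 0 s) * cupDiff l u) w = cupDiff (s :: l) w := by
  have h2 : (2 : ZMod 2) = 0 := CharTwo.two_eq_zero
  obtain _ | ⟨v, _ | ⟨x, w⟩⟩ := w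
  any_goals simp at hw
  have := coboundary_cupDiff l (v :: x :: w) (by simp [hw])
  simp only [coboundary] at this
  simp only [coboundary, cupDiff, List.head?_cons, Option.elim_some, coboundary_mul]
  linear_combination s v * this - (s v * cupDiff l (x :: w)) * h2

theorem cupDiff_eq_zero {X : Type*} {l : List (X → ZMod 2)} {w : List X}
    (hw : w.length = l.length + 1) {s : X → ZMod 2} (hs : s ∈ l)
    (h : ∀ x ∈ w, ∀ y ∈ w, s x = s y) : cupDiff l w = 0 := by
  induction l generalizing w with
  | nil => simp at hs
  | cons t l ih =>
    obtain _ | ⟨v, _ | ⟨x, w⟩⟩ := w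
    any_goals simp at hw
    rw [cupDiff]
    obtain rfl | hs := List.mem_cons.1 hs
    · rw [h v (by simp) x (by simp), CharTwo.add_self_eq_zero, zero_mul]
    · rw [ih (by simp [hw]) hs fun a ha b hb =>
        h a (List.mem_cons_of_mem _ ha) b (List.mem_cons_of_mem _ hb), mul_zero]

theorem cupDiff_map_neg {X : Type*} [Neg X] {l : List (X → ZMod 2)} {w : List X}
    (h : ∀ s ∈ l, ∀ x ∈ w, s (-x) = s x + 1) : cupDiff l (w.map (- ·)) = cupDiff l w := by
  induction l generalizing w with
  | nil => simp [cupDiff]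
  | cons s l ih =>
    obtain _ | ⟨v, _ | ⟨x, w⟩⟩ := w
    · rfl
    · rfl
    have := ih (w := x :: w) fun t ht a ha =>
      h t (List.mem_cons_of_mem _ ht) a (List.mem_cons_of_mem _ ha)
    simp only [List.map_cons] at this
    simp only [List.map_cons, cupDiff, this, h s (by simp) v (by simp), h s (by simp) x (by simp)]
    linear_combination cupDiff l (x :: w) * (CharTwo.two_eq_zero : (2 : ZMod 2) = 0)

/-! ### Small chains subdividing the hemispheres -/

section
variable {E : Type*} [NormedAddCommGroup E] [InnerProductSpace ℝ E]

/-- For orthogonal unit vectors `x` and `a`, the great circle through `x` and `a`: it is at `x` at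
time `0`, at `a` at time `π / 2`, and at `-x` at time `π`. -/
noncomputable def arc (a : E) (t : ℝ) (x : E) : E := Real.cos t • x + Real.sin t • a

theorem norm_arc {a x : E} (ha : ‖a‖ = 1) (hx : ‖x‖ = 1) (h : inner ℝ x a = 0) (t : ℝ) :
    ‖arc a t x‖ = 1 := by
  have : ‖arc a t x‖ ^ 2 = 1 := by
    rw [arc, norm_add_sq_real, norm_smul, norm_smul, inner_smul_left, inner_smul_right, h, ha, hx]
    simp
  exact (pow_eq_one_iff_of_nonneg (norm_nonneg _) two_ne_zero).1 this

theorem dist_arc_le {a x y : E} (ha : ‖a‖ = 1) (hx : ‖x‖ = 1) (s t : ℝ) :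
    dist (arc a s x) (arc a t y) ≤ dist x y + 2 * |s - t| := by
  have h1 : dist (arc a s x) (arc a t x) ≤ 2 * |s - t| := by
    have : arc a s x - arc a t x =
        (Real.cos s - Real.cos t) • x + (Real.sin s - Real.sin t) • a := by
      simp only [arc]; module
    rw [dist_eq_norm, this]
    refine (norm_add_le _ _).trans ?_
    rw [norm_smul, norm_smul, ha, hx, mul_one, mul_one, Real.norm_eq_abs, Real.norm_eq_abs]
    linarith [Real.abs_cos_sub_cos_le s t, Real.abs_sin_sub_sin_le s t]
  have h2 : dist (arc a t x) (arc a t y) ≤ dist x y := by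
    rw [arc, arc, dist_add_right, dist_smul₀, Real.norm_eq_abs]
    exact mul_le_of_le_one_left dist_nonneg (Real.abs_cos_le_one t)
  linarith [dist_triangle (arc a s x) (arc a t x) (arc a t y)]

/-- The `j`-th of `M` equal steps that move the sphere orthogonal to `a` to the pole `a`. -/
noncomputable def sweep (M : ℕ) (a : E) (j : ℕ) : E → E := arc a (j * (Real.pi / (2 * M)))

/-- Evaluation of a cochain on the `k`-chain `hₖ` that subdivides the upper hemisphere of the sphere
spanned by `e 0, …, e k`. Here `h₀` is the point `e 0`, and `hₖ₊₁` is the sum of the `M` prisms swept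
out by the cycle `hₖ + τhₖ`, with `τ` the antipode, while it moves to the pole `e (k + 1)`. -/
noncomputable def hemisphere (M : ℕ) (e : ℕ → E) : ℕ → (List E → ZMod 2) → ZMod 2
  | 0, θ => θ [e 0]
  | k + 1, θ => ∑ j ∈ Finset.range M, hemisphere M e k fun w =>
      prism (sweep M (e (k + 1)) j) (sweep M (e (k + 1)) (j + 1)) θ w +
      prism (sweep M (e (k + 1)) j) (sweep M (e (k + 1)) (j + 1)) θ (w.map (- ·))

theorem hemisphere_add (M : ℕ) (e : ℕ → E) (k : ℕ) (θ η : List E → ZMod 2) :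
    hemisphere M e k (fun w => θ w + η w) = hemisphere M e k θ + hemisphere M e k η := by
  induction k generalizing θ η with
  | zero => rfl
  | succ k ih =>
    simp only [hemisphere, prism_add, ih, Finset.sum_add_distrib]
    ring

theorem hemisphere_zero (M : ℕ) (e : ℕ → E) (k : ℕ) : hemisphere M e k (fun _ => 0) = 0 := by
  simpa using hemisphere_add M e k (fun _ => 0) (fun _ => 0)

/-- The dual form of `∂hₖ₊₁ = hₖ + τhₖ`. -/
theorem hemisphere_coboundary {M : ℕ} (hM : M ≠ 0) (e : ℕ → E) (k : ℕ) (θ : List E → ZMod 2) :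
    hemisphere M e (k + 1) (coboundary θ) = hemisphere M e k fun w => θ w + θ (w.map (- ·)) := by
  -- `hₖ + τhₖ` is a cycle; for `k = 0`, this holds for the augmented boundary.
  have key : ∀ η : List E → ZMod 2,
      hemisphere M e k (fun w => coboundary η w + coboundary η (w.map (- ·))) = 0 := by
    intro η
    cases k with
    | zero => simp [hemisphere, coboundary, CharTwo.add_self_eq_zero]
    | succ k =>
      simp only [← coboundary_comp_map, ← coboundary_add]
      rw [hemisphere_coboundary hM]
      simp [CharTwo.add_self_eq_zero, hemisphere_zero, add_comm]
  -- The value at `hₖ + τhₖ`, moved by the `j`-th step: it telescopes, and at the pole the words of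
  -- `hₖ` and `τhₖ` become equal and cancel.
  set B : ℕ → ZMod 2 := fun j => hemisphere M e k fun w =>
    θ (w.map (sweep M (e (k + 1)) j)) + θ ((w.map (- ·)).map (sweep M (e (k + 1)) j)) with hB
  have h0 : B 0 = hemisphere M e k fun w => θ w + θ (w.map (- ·)) := by
    have : sweep M (e (k + 1)) 0 = id := by ext x; simp [sweep, arc]
    simp only [hB, this, List.map_id]
  have h1 : B M = 0 := by
    have h : (M : ℝ) * (Real.pi / (2 * M)) = Real.pi / 2 := by field_simp
    have : sweep M (e (k + 1)) M = fun _ => e (k + 1) := by ext x; simp [sweep, arc, h]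
    simp only [hB, this, List.map_const', List.length_map, CharTwo.add_self_eq_zero,
      hemisphere_zero]
  rw [← h0, hemisphere, ← neg_eq_iff_eq_neg.2 (CharTwo.neg_eq (B 0)).symm, ← zero_sub, ← h1,
    ← Finset.sum_range_sub]
  refine Finset.sum_congr rfl fun j _ => ?_
  rw [CharTwo.sub_eq_add, ← add_zero (B (j + 1) + _), ← key (prism (sweep M (e (k + 1)) j)
    (sweep M (e (k + 1)) (j + 1)) θ)]
  simp only [hB, ← hemisphere_add, prism_coboundary]
  congr 1
  ext w
  ring

/-- The words that occur in the chain `hₖ` inside the span of `e 0, …, e (n - 1)`: they consist of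
`k + 1` unit vectors at mutual distance at most `kπ/M`, orthogonal to the later `e i`. -/
structure IsSmallWord (n M : ℕ) (e : ℕ → E) (k : ℕ) (w : List E) : Prop where
  length_eq : w.length = k + 1
  norm_eq : ∀ x ∈ w, ‖x‖ = 1
  inner_eq : ∀ x ∈ w, ∀ i, k < i → i < n → inner ℝ x (e i) = 0
  dist_le : ∀ x ∈ w, ∀ y ∈ w, dist x y ≤ k * (Real.pi / M)

theorem IsSmallWord.map_neg {n M : ℕ} {e : ℕ → E} {k : ℕ} {w : List E}
    (h : IsSmallWord n M e k w) : IsSmallWord n M e k (w.map (- ·)) where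
  length_eq := by simp [h.length_eq]
  norm_eq := List.forall_mem_map.2 fun x hx => by rw [norm_neg, h.norm_eq x hx]
  inner_eq := List.forall_mem_map.2 fun x hx i hi hin => by
    rw [inner_neg_left, h.inner_eq x hx i hi hin, neg_zero]
  dist_le := List.forall_mem_map.2 fun x hx => List.forall_mem_map.2 fun y hy => by
    rw [dist_neg_neg]
    exact h.dist_le x hx y hy

theorem IsSmallWord.of_sweep {n M : ℕ} {e : ℕ → E} {k : ℕ} (hk : k + 1 < n)
    (he : ∀ i < n, ‖e i‖ = 1) (ho : ∀ i < n, ∀ j < n, i ≠ j → inner ℝ (e i) (e j) = 0)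
    {w u : List E} (h : IsSmallWord n M e k w) (j : ℕ) (hu : u.length = w.length + 1)
    (hu' : ∀ x ∈ u, ∃ y ∈ w,
      x = sweep M (e (k + 1)) j y ∨ x = sweep M (e (k + 1)) (j + 1) y) :
    IsSmallWord n M e (k + 1) u := by
  have hu' : ∀ x ∈ u, ∃ y ∈ w, ∃ i : ℕ, (i = j ∨ i = j + 1) ∧
      x = arc (e (k + 1)) (i * (Real.pi / (2 * M))) y := fun x hx => by
    obtain ⟨y, hy, h | h⟩ := hu' x hx
    · exact ⟨y, hy, j, .inl rfl, h⟩
    · exact ⟨y, hy, j + 1, .inr rfl, h⟩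
  refine ⟨by rw [hu, h.length_eq], fun x hx => ?_, fun x hx i hi hin => ?_, fun x hx y hy => ?_⟩
  · obtain ⟨y, hy, i, -, rfl⟩ := hu' x hx
    exact norm_arc (he _ hk) (h.norm_eq y hy) (h.inner_eq y hy _ (Nat.lt_succ_self k) hk) _
  · obtain ⟨y, hy, i', -, rfl⟩ := hu' x hx
    rw [arc, inner_add_left, inner_smul_left, inner_smul_left, h.inner_eq y hy i (by omega) hin,
      ho _ hk _ hin (by omega), mul_zero, mul_zero, add_zero]
  · obtain ⟨x, hxw, i, hi, rfl⟩ := hu' x hx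
    obtain ⟨y, hyw, i', hi', rfl⟩ := hu' y hy
    refine (dist_arc_le (he _ hk) (h.norm_eq x hxw) _ _).trans ?_
    have h1 : |(i : ℝ) - i'| ≤ 1 := by
      rcases hi with rfl | rfl <;> rcases hi' with rfl | rfl <;> simp
    have h2 : 0 ≤ Real.pi / (2 * M) := by positivity
    rw [← sub_mul, abs_mul, abs_of_nonneg h2]
    have h3 := mul_le_mul_of_nonneg_right h1 h2
    have h4 := h.dist_le x hxw y hyw
    have h5 : Real.pi / M = 2 * (Real.pi / (2 * M)) := by ring
    push_cast
    rw [h5] at h4 ⊢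
    linarith

/-- The chain `hₖ` consists of small words only. -/
theorem hemisphere_congr {n M : ℕ} {e : ℕ → E} (he : ∀ i < n, ‖e i‖ = 1)
    (ho : ∀ i < n, ∀ j < n, i ≠ j → inner ℝ (e i) (e j) = 0) {k : ℕ} (hk : k < n)
    {θ η : List E → ZMod 2} (h : ∀ w, IsSmallWord n M e k w → θ w = η w) :
    hemisphere M e k θ = hemisphere M e k η := by
  induction k generalizing θ η with
  | zero =>
    refine h _ ⟨rfl, by simpa using he 0 hk, ?_, by simp⟩
    simp only [List.mem_singleton, forall_eq]
    exact fun i hi hin => ho 0 hk i hin hi.ne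
  | succ k ih =>
    refine Finset.sum_congr rfl fun j _ => ih (by omega) fun w hw => ?_
    congr 1
    · exact prism_congr fun u hu hu' => h u (hw.of_sweep hk he ho j hu hu')
    · exact prism_congr fun u hu hu' => h u (hw.map_neg.of_sweep hk he ho j hu hu')

theorem hemisphere_cupDiff {n M : ℕ} (hM : M ≠ 0) {e : ℕ → E} (he : ∀ i < n, ‖e i‖ = 1)
    (ho : ∀ i < n, ∀ j < n, i ≠ j → inner ℝ (e i) (e j) = 0) (l : List (E → ZMod 2))
    (hl : l.length < n) (hs : ∀ s ∈ l, ∀ x : E, ‖x‖ = 1 → s (-x) = s x + 1) :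
    hemisphere M e l.length (cupDiff l) = 1 := by
  induction l with
  | nil => rfl
  | cons s l ih =>
    have hl' : l.length < n := by simp at hl; omega
    have hs' := fun t ht => hs t (List.mem_cons_of_mem s ht)
    rw [← ih hl' hs']
    simp only [List.length_cons] at hl ⊢
    rw [hemisphere_congr he ho hl fun w hw =>
      (coboundary_mul_cupDiff s l w hw.length_eq).symm, hemisphere_coboundary hM]
    refine hemisphere_congr he ho hl' fun w hw => ?_
    rw [cupDiff_map_neg fun t ht x hx => hs' t ht x (hw.norm_eq x hx)]
    obtain _ | ⟨v, w⟩ := w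
    · simpa using hw.length_eq
    simp only [List.map_cons, List.head?_cons, Option.elim_some,
      hs s (by simp) v (hw.norm_eq v (by simp))]
    linear_combination (s v * cupDiff l (v :: w)) * (CharTwo.two_eq_zero : (2 : ZMod 2) = 0)

/-- A `ℤ/2`-valued sign of a real function `F` that is odd wherever `F` is, also at the zeros
of `F`. -/
theorem exists_odd_sign (F : E → ℝ) :
    ∃ s : E → ZMod 2, (∀ x, x ≠ 0 → F (-x) = -F x → s (-x) = s x + 1) ∧
      (∀ x, 0 < F x → s x = 1) ∧ ∀ x, F x < 0 → s x = 0 := by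
  classical
  -- An arbitrary linear order breaks the tie between `x` and `-x` where `F` vanishes.
  let _ : LinearOrder E := IsWellOrder.linearOrder WellOrderingRel
  refine ⟨fun x => if 0 < F x ∨ (F x = 0 ∧ x < -x) then 1 else 0, fun x hx hF => ?_,
    fun x h => by simp [h], fun x h => by simp [h.not_gt, h.ne]⟩
  have h11 : (1 + 1 : ZMod 2) = 0 := rfl
  have hne : x ≠ -x := fun h => hx <| by
    have : (2 : ℝ) • x = 0 := by rw [two_smul, add_eq_zero_iff_eq_neg, ← h]
    exact (smul_eq_zero.1 this).resolve_left two_ne_zero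
  simp only [hF, neg_neg, Left.neg_pos_iff, neg_eq_zero]
  rcases lt_trichotomy (F x) 0 with h | h | h
  · simp [h, h.not_gt, h.ne]
  · rcases hne.lt_or_gt with h' | h' <;> simp [h, h', h'.not_gt, h11]
  · simp [h, h.not_gt, h.ne', h11]

end

/-! ### The Borsuk–Ulam theorem -/

/-- The Borsuk–Ulam theorem: an odd map from the `(n-1)`-sphere to `ℝᵐ` with `m < n` has a zero. -/
theorem exists_eq_zero_of_odd {n m : ℕ} (hmn : m < n)
    (f : C(Metric.sphere (0 : EuclideanSpace ℝ (Fin n)) 1, Fin m → ℝ))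
    (hf : ∀ x, f (-x) = -f x) : ∃ x, f x = 0 := by
  classical
  by_contra! hne
  obtain ⟨ε, hε, hfε⟩ : ∃ ε > 0, ∀ x, ε ≤ ‖f x‖ := by
    rcases isEmpty_or_nonempty (Metric.sphere (0 : EuclideanSpace ℝ (Fin n)) 1) with h | h
    · exact ⟨1, one_pos, fun x => (h.false x).elim⟩
    · obtain ⟨x, -, hx⟩ := isCompact_univ.exists_isMinOn Set.univ_nonempty
        f.continuous.norm.continuousOn
      exact ⟨‖f x‖, norm_pos_iff.2 (hne x), fun y => hx (Set.mem_univ y)⟩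
  obtain ⟨δ, hδ, hfδ⟩ := Metric.uniformContinuous_iff.1
    (CompactSpace.uniformContinuous_of_continuous f.continuous) ε hε
  obtain ⟨M, hM0, hM⟩ : ∃ M : ℕ, M ≠ 0 ∧ m * (Real.pi / M) < δ := by
    obtain ⟨M, hM⟩ := exists_nat_gt (m * Real.pi / δ)
    have h0 : 0 < (M : ℝ) := lt_of_le_of_lt (by positivity) hM
    refine ⟨M, by exact_mod_cast h0.ne', ?_⟩
    rw [← mul_div_assoc]
    rwa [div_lt_comm₀ h0 hδ]
  let F : Fin m → EuclideanSpace ℝ (Fin n) → ℝ := fun i x => 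
    if h : ‖x‖ = 1 then f ⟨x, mem_sphere_zero_iff_norm.2 h⟩ i else 0
  choose s hs_odd hs_pos hs_neg using fun i => exists_odd_sign (F i)
  let e : ℕ → EuclideanSpace ℝ (Fin n) := fun i =>
    if h : i < n then EuclideanSpace.single ⟨i, h⟩ 1 else 0
  have he : ∀ i < n, ‖e i‖ = 1 := fun i hi => by simp [e, hi]
  have ho : ∀ i < n, ∀ j < n, i ≠ j → inner ℝ (e i) (e j) = 0 := fun i hi j hj hij => by
    simp [e, hi, hj, EuclideanSpace.inner_single_left, hij]
  have h1 := hemisphere_cupDiff hM0 he ho (List.ofFn s) (by simpa using hmn) (by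
    intro t ht x hx
    obtain ⟨i, rfl⟩ := (List.mem_ofFn' _ _).1 ht
    refine hs_odd i x (norm_ne_zero_iff.1 (by simp [hx])) ?_
    have hx' : ‖-x‖ = 1 := by rw [norm_neg, hx]
    simp only [F, hx, hx', dif_pos]
    exact congrFun (hf ⟨x, mem_sphere_zero_iff_norm.2 hx⟩) i)
  rw [hemisphere_congr he ho (by simpa using hmn) (η := fun _ => 0), hemisphere_zero] at h1
  · exact zero_ne_one h1
  intro w hw
  obtain _ | ⟨v, w⟩ := w
  · simpa using hw.length_eq
  have hv := mem_sphere_zero_iff_norm.2 (hw.norm_eq v (by simp))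
  obtain ⟨i, hi⟩ : ∃ i, ε ≤ |f ⟨v, hv⟩ i| := by
    by_contra! h
    exact (hfε ⟨v, hv⟩).not_gt ((pi_norm_lt_iff hε).2 h)
  have hclose : ∀ x ∈ v :: w, |F i x - f ⟨v, hv⟩ i| < ε := fun x hx => by
    have h := hw.dist_le x hx v (by simp)
    rw [List.length_ofFn] at h
    have := hfδ (a := ⟨x, mem_sphere_zero_iff_norm.2 (hw.norm_eq x hx)⟩) (b := ⟨v, hv⟩)
      (h.trans_lt hM)
    simp only [F, hw.norm_eq x hx, dif_pos]
    exact (dist_pi_lt_iff hε).1 this i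
  refine cupDiff_eq_zero hw.length_eq ((List.mem_ofFn' s _).2 ⟨i, rfl⟩) ?_
  rcases le_abs'.1 hi with h | h
  · have : ∀ x ∈ v :: w, s i x = 0 := fun x hx =>
      hs_neg i x (by linarith [(abs_lt.1 (hclose x hx)).2])
    exact fun x hx y hy => (this x hx).trans (this y hy).symm
  · have : ∀ x ∈ v :: w, s i x = 1 := fun x hx =>
      hs_pos i x (by linarith [(abs_lt.1 (hclose x hx)).1])
    exact fun x hx y hy => (this x hx).trans (this y hy).symm

/-! ### Points of `Hom(T, G)` -/

section
variable {U V : Type*} [Fintype V] {T : SimpleGraph U} {G : SimpleGraph V}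

theorem mem_homComplex_iff {x : U → V → ℝ} :
    x ∈ homComplex T G ↔ (∀ u, x u ∈ stdSimplex ℝ V) ∧
      ∀ u u', T.Adj u u' → ∀ v v', x u v ≠ 0 → x u' v' ≠ 0 → G.Adj v v' := by
  classical
  constructor
  · rintro ⟨φ, ⟨hne, hφ⟩, hx⟩
    refine ⟨fun u => (hx u).1, fun u u' hu v v' hv hv' => ?_⟩
    choose g hg using hne
    obtain ⟨h, hh⟩ := hφ (Function.update (Function.update g u v) u' v') fun a => by
      rcases eq_or_ne a u' with rfl | h1
      · simpa using (hx a).2 v' hv'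
      rcases eq_or_ne a u with rfl | h2
      · simpa [h1] using (hx a).2 v hv
      · simpa [h1, h2] using hg a
    have := h.map_adj hu
    simpa [hh, hu.ne] using this
  · rintro ⟨h1, h2⟩
    refine ⟨fun u => {v | x u v ≠ 0}, ⟨fun u => ?_, fun f hf => ?_⟩, fun u => ⟨h1 u, fun v => id⟩⟩
    · by_contra h
      have h0 : ∀ v, x u v = 0 := by simpa [Set.Nonempty] using h
      simpa [h0] using (h1 u).2
    · exact ⟨⟨f, fun hu => h2 _ _ hu _ _ (hf _) (hf _)⟩, rfl⟩

theorem exists_ne_zero_of_mem_stdSimplex {a : V → ℝ} (ha : a ∈ stdSimplex ℝ V) :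
    ∃ v, a v ≠ 0 := by
  by_contra! h
  simpa [h] using ha.2

/-- Discard the coordinates of `a` that are at most `ε`, lower the others by `ε`, and rescale to
coordinate sum `1`. This depends continuously on `a` as long as `ε` is less than the inverse of the
number of coordinates. -/
noncomputable def truncate (ε : ℝ) (a : V → ℝ) : V → ℝ :=
  fun v => max (a v - ε) 0 / ∑ w, max (a w - ε) 0

theorem sum_truncate_pos {ε : ℝ} (hε : ε * Fintype.card V < 1) {a : V → ℝ}
    (ha : a ∈ stdSimplex ℝ V) : 0 < ∑ w, max (a w - ε) 0 := by
  have : ∑ w, (a w - ε) ≤ ∑ w, max (a w - ε) 0 :=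
    Finset.sum_le_sum fun w _ => le_max_left _ _
  rw [Finset.sum_sub_distrib, ha.2, Finset.sum_const, Finset.card_univ, nsmul_eq_mul] at this
  linarith

theorem truncate_mem_stdSimplex {ε : ℝ} (hε : ε * Fintype.card V < 1) {a : V → ℝ}
    (ha : a ∈ stdSimplex ℝ V) : truncate ε a ∈ stdSimplex ℝ V := by
  have h := sum_truncate_pos hε ha
  refine ⟨fun v => div_nonneg (le_max_right _ _) h.le, ?_⟩
  simp only [truncate]
  rw [← Finset.sum_div, div_self h.ne']

theorem lt_of_truncate_ne_zero {ε : ℝ} {a : V → ℝ} {v : V} (h : truncate ε a v ≠ 0) :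
    ε < a v := by
  by_contra! hv
  exact h (by simp [truncate, max_eq_right (sub_nonpos.2 hv)])

theorem continuous_truncate {ε : ℝ} (hε : ε * Fintype.card V < 1) {X : Type*}
    [TopologicalSpace X] {f : X → V → ℝ} (hf : Continuous f) (h : ∀ x, f x ∈ stdSimplex ℝ V) :
    Continuous fun x => truncate ε (f x) := by
  have hc : ∀ v, Continuous fun x => max (f x v - ε) 0 := fun v =>
    (((continuous_apply v).comp hf).sub continuous_const).max continuous_const
  exact continuous_pi fun v => (hc v).div (continuous_finsetSum _ fun w _ => hc w)
    fun x => (sum_truncate_pos hε (h x)).ne'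

end

/-! ### Equivariant maps from spheres to `Hom(C_{2r+1}, G)` -/

theorem HasSphereMap.comp {X Y : Type*} [TopologicalSpace X] [TopologicalSpace Y] {τ : X → X}
    {σ : Y → Y} {n : ℕ} (h : HasSphereMap τ n) (g : C(X, Y)) (hg : ∀ x, g (τ x) = σ (g x)) :
    HasSphereMap σ n := by
  obtain ⟨f, hf⟩ := h
  exact ⟨g.comp f, fun x => by simp [hf, hg]⟩

theorem hasSphereMap_zero {X : Type*} [TopologicalSpace X] (τ : X → X) : HasSphereMap τ 0 := by
  have : IsEmpty (Metric.sphere (0 : EuclideanSpace ℝ (Fin 0)) 1) :=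
    ⟨fun x => by simpa [Subsingleton.elim x.1 0] using x.2⟩
  exact ⟨⟨fun x => isEmptyElim x, continuous_of_const fun x => isEmptyElim x⟩,
    fun x => isEmptyElim x⟩

theorem cycleGraph_adj_iff {r : ℕ} (hr : 1 ≤ r) (u v : Fin (2 * r + 1)) :
    (SimpleGraph.cycleGraph (2 * r + 1)).Adj u v ↔
      v.1 = u.1 + 1 ∨ u.1 = v.1 + 1 ∨ (u.1 = 0 ∧ v.1 = 2 * r) ∨ (v.1 = 0 ∧ u.1 = 2 * r) := by
  have h := u.2
  have h' := v.2
  rw [SimpleGraph.cycleGraph_adj']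
  have key : ∀ a b : Fin (2 * r + 1), (a - b).1 = 1 ↔ a.1 = b.1 + 1 ∨ (a.1 = 0 ∧ b.1 = 2 * r) := by
    intro a b
    rw [Fin.sub_def]
    simp only
    have ha := a.2
    have hb := b.2
    rcases lt_or_ge a.1 b.1 with h | h
    · rw [Nat.mod_eq_of_lt (by omega)]
      omega
    · rw [show 2 * r + 1 - b.1 + a.1 = (a.1 - b.1) + (2 * r + 1) by omega, Nat.add_mod_right,
        Nat.mod_eq_of_lt (by omega)]
      omega
  rw [key, key]
  omega

section
variable {V : Type*} [Fintype V] {G : SimpleGraph V}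

/-- The homomorphism `C_{2r+3} → C_{2r+1}` with `v ↦ 2r + 1 - v` for `0 < v < 2r + 2`, which sends the
ends `0` and `2r + 2` to `0` and `2r`. It commutes with the flips (`cycleFold_rev`). -/
def cycleFold (r : ℕ) (hr : 1 ≤ r) :
    SimpleGraph.cycleGraph (2 * (r + 1) + 1) →g SimpleGraph.cycleGraph (2 * r + 1) where
  toFun v := if h0 : v.1 = 0 then ⟨0, by omega⟩ else if v.1 = 2 * r + 2 then ⟨2 * r, by omega⟩
    else ⟨2 * r + 1 - v.1, by omega⟩
  map_rel' := by
    intro u v huv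
    rw [cycleGraph_adj_iff (by omega)] at huv
    rw [cycleGraph_adj_iff hr]
    have hu := u.2
    have hv := v.2
    split_ifs <;> dsimp only <;> omega

theorem cycleFold_rev (r : ℕ) (hr : 1 ≤ r) (v : Fin (2 * (r + 1) + 1)) :
    cycleFold r hr v.rev = (cycleFold r hr v).rev := by
  have hv := v.2
  ext
  simp only [cycleFold, RelHom.coeFn_mk, Fin.val_rev]
  split_ifs <;> dsimp only <;> omega

theorem HasSphereMap.cycle_succ {r n : ℕ} (hr : 1 ≤ r)
    (h : HasSphereMap (homAct (cycleFlip r) G) n) :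
    HasSphereMap (homAct (cycleFlip (r + 1)) G) n := by
  refine h.comp ⟨fun x => ⟨fun u => x.1 (cycleFold r hr u), ?_⟩, ?_⟩ ?_
  · have := mem_homComplex_iff.1 x.2
    exact mem_homComplex_iff.2 ⟨fun u => this.1 _, fun u u' hu =>
      this.2 _ _ ((cycleFold r hr).map_adj hu)⟩
  · exact Continuous.subtype_mk (continuous_pi fun u =>
      (continuous_apply (cycleFold r hr u)).comp 
        (continuous_subtype_val (p := (· ∈ homComplex _ G)))) _
  · intro x
    ext u
    simp [homAct, cycleFlip, cycleFold_rev]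

theorem HasSphereMap.cycle_le_card {r n : ℕ} (hr : 1 ≤ r)
    (h : HasSphereMap (homAct (cycleFlip r) G) n) : n ≤ Fintype.card V := by
  obtain ⟨f, hf⟩ := h
  by_contra! hn
  let e := Fintype.equivFin V
  -- The edge joining `0` and `2r` is flipped, so the difference of the values there is odd.
  have hc : ∀ u v, Continuous fun x => (f x).1 u v := fun u v =>
    (continuous_apply v).comp ((continuous_apply u).comp (continuous_subtype_val.comp f.continuous))
  obtain ⟨x, hx⟩ := exists_eq_zero_of_odd hn
    ⟨fun x i => (f x).1 0 (e.symm i) - (f x).1 (Fin.last _) (e.symm i),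
      continuous_pi fun i => (hc _ _).sub (hc _ _)⟩ fun x => by
        ext i
        simp [hf, homAct, cycleFlip]
  obtain ⟨h1, h2⟩ := mem_homComplex_iff.1 (f x).2
  obtain ⟨v, hv⟩ := exists_ne_zero_of_mem_stdSimplex (h1 0)
  have hv' : (f x).1 (Fin.last _) v = (f x).1 0 v := by
    have := congrFun hx (e v)
    simp at this
    linarith
  exact G.loopless.irrefl v (h2 0 (Fin.last _)
    ((cycleGraph_adj_iff hr _ _).2 (by simp)) v v hv (by rwa [hv']))

end

/-! ### From sphere maps for `K₂` to sphere maps for odd cycles -/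

/-- A sphere map to `Hom(K₂, G)` yields, for some odd cycle, a sphere map one dimension lower, by
sampling the two components alternately along half great circles through a pole. -/
theorem HasSphereMap.exists_cycle {V : Type*} [Fintype V] {G : SimpleGraph V} {n : ℕ}
    (h : HasSphereMap (homAct edgeFlip G) (n + 1)) :
    ∃ r, 1 ≤ r ∧ HasSphereMap (homAct (cycleFlip r) G) n := by
  obtain ⟨F, hF⟩ := h
  obtain ⟨ε, hε0, hε⟩ : ∃ ε : ℝ, 0 < ε ∧ ε * Fintype.card V < 1 := by
    refine ⟨1 / (Fintype.card V + 1), by positivity, ?_⟩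
    rw [one_div_mul_eq_div, div_lt_one (by positivity)]
    linarith
  have hFc : Continuous fun p => (F p).1 := continuous_subtype_val.comp F.continuous
  have hFs := fun p => (mem_homComplex_iff.1 (F p).2).1
  have hFn : ∀ p, (F (-p)).1 1 = (F p).1 0 := fun p => by simp [hF, homAct, edgeFlip]
  obtain ⟨δ, hδ, hFδ⟩ := Metric.uniformContinuous_iff.1
    (CompactSpace.uniformContinuous_of_continuous hFc) ε hε0
  -- Truncated components at nearby points `p`, `q` are joined: a coordinate exceeding `ε` at `q` is
  -- still positive at `p`.
  have hjoin : ∀ p q, dist p q < δ → ∀ i j : Fin 2, i ≠ j → ∀ v w,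
      truncate ε ((F p).1 i) v ≠ 0 → truncate ε ((F q).1 j) w ≠ 0 → G.Adj v w := by
    intro p q hpq i j hij v w hv hw
    have hv := lt_of_truncate_ne_zero hv
    have hw := lt_of_truncate_ne_zero hw
    have hd : dist ((F p).1 j w) ((F q).1 j w) < ε :=
      (dist_pi_lt_iff hε0).1 ((dist_pi_lt_iff hε0).1 (hFδ hpq) j) w
    rw [Real.dist_eq] at hd
    exact (mem_homComplex_iff.1 (F p).2).2 i j hij v w (by linarith)
      (by linarith [(abs_lt.1 hd).1])
  obtain ⟨r, hr, hrδ⟩ : ∃ r : ℕ, 1 ≤ r ∧ Real.pi / r < δ := by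
    obtain ⟨r, hr⟩ := exists_nat_gt (Real.pi / δ)
    have h0 : 0 < (r : ℝ) := lt_of_le_of_lt (by positivity) hr
    exact ⟨r, by exact_mod_cast h0, by rwa [div_lt_comm₀ h0 hδ]⟩
  have hr0 : (r : ℝ) ≠ 0 := by positivity
  obtain ⟨e, he⟩ : ∃ e : EuclideanSpace ℝ (Fin (n + 1)), ‖e‖ = 1 :=
    ⟨EuclideanSpace.single 0 1, by simp⟩
  have : Fact (Module.finrank ℝ (EuclideanSpace ℝ (Fin (n + 1))) = n + 1) := ⟨by simp⟩
  -- The equatorial sphere orthogonal to the pole `e`, and the sample points `p j y` on the half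
  -- circle from `y` through `e` to `-y`.
  let ι : EuclideanSpace ℝ (Fin n) →ₗᵢ[ℝ] EuclideanSpace ℝ (Fin (n + 1)) :=
    (Submodule.subtypeₗᵢ _).comp (OrthonormalBasis.fromOrthogonalSpanSingleton (𝕜 := ℝ) n
      (norm_ne_zero_iff.1 (he.trans_ne one_ne_zero))).repr.symm.toLinearIsometry
  have hι : ∀ y, inner ℝ (ι y) e = 0 := fun y => by
    rw [real_inner_comm]
    exact Submodule.mem_orthogonal_singleton_iff_inner_right.1 (Subtype.prop _)
  have hι1 : ∀ y : Metric.sphere (0 : EuclideanSpace ℝ (Fin n)) 1, ‖ι y‖ = 1 := fun y => by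
    rw [ι.norm_map, norm_eq_of_mem_sphere]
  let p : ℕ → Metric.sphere (0 : EuclideanSpace ℝ (Fin n)) 1 →
      Metric.sphere (0 : EuclideanSpace ℝ (Fin (n + 1))) 1 := fun j y =>
    ⟨arc e (j * (Real.pi / (2 * r))) (ι y),
      mem_sphere_zero_iff_norm.2 (norm_arc he (hι1 y) (hι y) _)⟩
  have hpc : ∀ j, Continuous (p j) := fun j => Continuous.subtype_mk (by unfold arc; fun_prop) _
  have hp0 : ∀ y, -p 0 y = p (2 * r) y := fun y => by
    ext1
    have : (2 * r : ℝ) * (Real.pi / (2 * r)) = Real.pi := by field_simp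
    simp [p, arc, this]
  have hpn : ∀ j ≤ 2 * r, ∀ y, p (2 * r - j) y = p j (-y) := fun j hj y => by
    ext1
    have : (2 * r - j : ℝ) * (Real.pi / (2 * r)) = Real.pi - j * (Real.pi / (2 * r)) := by
      field_simp
    simp [p, arc, this, Nat.cast_sub hj, Real.cos_pi_sub, Real.sin_pi_sub]
  have hpd : ∀ j y, dist (p j y) (p (j + 1) y) < δ := fun j y => by
    refine lt_of_le_of_lt (dist_arc_le he (hι1 y) _ _) ?_
    have h1 : (j : ℝ) * (Real.pi / (2 * r)) - ((j + 1 : ℕ) : ℝ) * (Real.pi / (2 * r)) =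
        -(Real.pi / (2 * r)) := by push_cast; ring
    rw [dist_self, zero_add, h1, abs_neg, abs_of_nonneg (by positivity)]
    calc 2 * (Real.pi / (2 * r)) = Real.pi / r := by ring
      _ < δ := hrδ
  -- The component of `F` to be used at the `j`-th sample point.
  let c : ℕ → Fin 2 := fun j => if j % 2 = 0 then 0 else 1
  have hc : ∀ j, c j ≠ c (j + 1) := fun j => by
    rcases Nat.mod_two_eq_zero_or_one j with h | h <;> simp [c, h, Nat.add_mod]
  have hstep : ∀ j y v w, truncate ε ((F (p j y)).1 (c j)) v ≠ 0 →
      truncate ε ((F (p (j + 1) y)).1 (c (j + 1))) w ≠ 0 → G.Adj v w := fun j y =>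
    hjoin _ _ (hpd j y) _ _ (hc j)
  -- The closing edge: `F` at `p (2 * r) y = -y` has the components of `F y` interchanged.
  have hclose : ∀ y v w, truncate ε ((F (p 0 y)).1 (c 0)) v ≠ 0 →
      truncate ε ((F (p (2 * r) y)).1 (c (2 * r))) w ≠ 0 → G.Adj v w := by
    intro y v w hv hw
    refine hjoin (p 0 y) (p 0 y) (by simpa using hδ) 0 1 (by decide) v w (by simpa [c] using hv) ?_
    have := hFn (-p 0 y)
    rw [neg_neg] at this
    rw [this, hp0]
    simpa [c] using hw
  refine ⟨r, hr, ⟨fun y => ⟨fun u => truncate ε ((F (p u y)).1 (c u)),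
    mem_homComplex_iff.2 ⟨fun u => truncate_mem_stdSimplex hε (hFs _ _), ?_⟩⟩,
    Continuous.subtype_mk (continuous_pi fun u => continuous_truncate hε
      ((continuous_apply _).comp (hFc.comp (hpc _))) fun y => hFs _ _) _⟩, fun y => ?_⟩
  · intro u u' hu v v' hv hv'
    rcases (cycleGraph_adj_iff hr u u').1 hu with h | h | ⟨h, h'⟩ | ⟨h, h'⟩
    · rw [h] at hv'
      exact hstep _ y v v' hv hv'
    · rw [h] at hv
      exact (hstep _ y v' v hv' hv).symm
    · rw [h] at hv
      rw [h'] at hv'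
      exact hclose y v v' hv hv'
    · rw [h'] at hv
      rw [h] at hv'
      exact (hclose y v' v hv' hv).symm
  · have key : ∀ j ≤ 2 * r, c (2 * r - j) = c j := fun j hj => by
      have : (2 * r - j) % 2 = j % 2 := by omega
      simp only [c, this]
    ext u : 2
    have hu := Nat.le_of_lt_succ u.2
    have hrev : ((cycleFlip r u : Fin (2 * r + 1)) : ℕ) = 2 * r - u := by
      simp [cycleFlip, Fin.val_rev]
    simp only [homAct, ContinuousMap.coe_mk, hrev, hpn _ hu, key _ hu]

theorem mainTheorem3 {V : Type*} [Fintype V] (G : SimpleGraph V) (hG : ∃ u v, G.Adj u v) :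
    (∃ L : ℤ, Tendsto (fun r : ℕ => coindCycle G r) atTop (𝓝 ((L : ℝ) : EReal)) ∧
        coindEdge G ≤ ((L : ℝ) : EReal) + 1) ∧
      ∀ᶠ r : ℕ in atTop, lovaszBound G ≤ babsonKozlovBound G r := by
  -- The largest `N` for which the sphere of `ℝᴺ` maps to some `Hom(C_{2r+1}, G)`. The cycle `r = 0`
  -- is excluded: there `Hom` is a simplex, to which all spheres map.
  let S : Set ℕ := {n | ∃ r, 1 ≤ r ∧ HasSphereMap (homAct (cycleFlip r) G) n}
  have hbdd : BddAbove S := ⟨Fintype.card V, fun n ⟨r, hr, h⟩ => h.cycle_le_card hr⟩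
  obtain ⟨N, ⟨r₀, hr₀, hN⟩, hmax⟩ : ∃ N ∈ S, ∀ n ∈ S, n ≤ N :=
    ⟨sSup S, Nat.sSup_mem ⟨0, 1, le_rfl, hasSphereMap_zero _⟩ hbdd, fun n hn => le_csSup hbdd hn⟩
  have hcycle : ∀ r, r₀ ≤ r → coindCycle G r = (((N : ℝ) - 1 : ℝ) : EReal) := by
    intro r hr
    have hN' : HasSphereMap (homAct (cycleFlip r) G) N := by
      induction r, hr using Nat.le_induction with
      | base => exact hN
      | succ r hr ih => exact ih.cycle_succ (hr₀.trans hr)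
    refine le_antisymm (sSup_le ?_) (le_sSup ⟨N, hN', rfl⟩)
    rintro _ ⟨n, hn, rfl⟩
    have : (n : ℝ) ≤ N := by exact_mod_cast hmax n ⟨r, hr₀.trans hr, hn⟩
    exact EReal.coe_le_coe_iff.2 (by linarith)
  have hedge : coindEdge G ≤ (((N : ℝ) - 1 : ℝ) : EReal) + 1 := by
    have h1 : (((N : ℝ) - 1 : ℝ) : EReal) + 1 = ((N : ℝ) : EReal) := by
      rw [← EReal.coe_one, ← EReal.coe_add, sub_add_cancel]
    rw [h1]
    refine sSup_le ?_
    rintro _ ⟨_ | n, hn, rfl⟩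
    · exact EReal.coe_le_coe_iff.2 (by simp; linarith [Nat.cast_nonneg (α := ℝ) N])
    · have : (n : ℝ) ≤ N := by exact_mod_cast hmax n hn.exists_cycle
      exact EReal.coe_le_coe_iff.2 (by push_cast; linarith)
  refine ⟨⟨(N : ℤ) - 1, ?_, by simpa using hedge⟩, ?_⟩
  · refine tendsto_const_nhds.congr' ((eventually_ge_atTop r₀).mono fun r hr => ?_)
    simp [hcycle r hr]
  · filter_upwards [eventually_ge_atTop r₀] with r hr
    rw [lovaszBound, babsonKozlovBound, hcycle r hr]
    calc coindEdge G + 2 ≤ (((N : ℝ) - 1 : ℝ) : EReal) + 1 + 2 := add_le_add_left hedge 2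
      _ = (((N : ℝ) - 1 : ℝ) : EReal) + 3 := by rw [add_assoc]; norm_num
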